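/- For complex numbers $a,x$ with $|x|<1$ write $(a;x)_n=\prod_{i=0}^{n-1}(1-ax^i)$ and $(a;x)_\infty=\prod_{i=0}^{\infty}(1-ax^i)$. For $N\ge 0$ let $c(N)$ be the number of partitions of $N$ whose smallest part occurs exactly once and in which each odd part is less than twice the smallest part (the empty partition is not counted, so $c(0)=0$). Then, for every complex number $q$ with $|q|<1$, all the series below converge absolutely and $$\sum_{N=0}^{\infty}c(N)\,q^N=\sum_{n=1}^{\infty}\frac{q^n}{(q^{n+1};q)_n\,(q^{2n+2};q^2)_\infty}=q^2\sum_{m=0}^{\infty}\frac{q^{3m}}{(q;q^2)_{m+1}}+\frac{q}{(q^2;q^2)_\infty}.$$ -/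

import Mathlib

/-- The finite q-Pochhammer symbol `(a; q)_n = ∏_{i=0}^{n-1} (1 - a q^i)`. -/
noncomputable def qPoch (a q : ℂ) (n : ℕ) : ℂ :=
  ∏ i ∈ Finset.range n, (1 - a * q ^ i)

/-- The infinite q-Pochhammer symbol `(a; q)_∞ = ∏_{i ≥ 0} (1 - a q^i)`, for `‖q‖ < 1`. -/
noncomputable def qPochInf (a q : ℂ) : ℂ :=
  ∏' i : ℕ, (1 - a * q ^ i)

/-- For `‖q‖ < 1` the infinite symbol is the limit of the finite ones. -/
theorem tendsto_qPoch (a q : ℂ) (hq : ‖q‖ < 1) :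
    Filter.Tendsto (qPoch a q) Filter.atTop (nhds (qPochInf a q)) := by
  have hs : Summable fun i : ℕ => ‖-(a * q ^ i)‖ := by
    simpa [norm_mul, norm_pow] using
      (summable_geometric_of_lt_one (norm_nonneg q) hq).mul_left ‖a‖
  have hm : Multipliable fun i : ℕ => (1 - a * q ^ i) := by
    simpa [sub_eq_add_neg] using multipliable_one_add_of_summable hs
  exact hm.tendsto_prod_tprod_nat

/-- For `‖q‖ < 1` the infinite symbol vanishes only if one of its factors does. -/
theorem qPochInf_ne_zero (a q : ℂ) (hq : ‖q‖ < 1) (ha : ∀ i : ℕ, 1 - a * q ^ i ≠ 0) :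
    qPochInf a q ≠ 0 := by
  have hs : Summable fun i : ℕ => ‖-(a * q ^ i)‖ := by
    simpa [norm_mul, norm_pow] using
      (summable_geometric_of_lt_one (norm_nonneg q) hq).mul_left ‖a‖
  have h := tprod_one_add_ne_zero_of_summable (f := fun i : ℕ => -(a * q ^ i))
    (by simpa [sub_eq_add_neg] using ha) hs
  simpa [qPochInf, sub_eq_add_neg] using h

/-- The partition `p` has a smallest part `m` that occurs exactly once, and every odd part of `p`
is less than `2 * m`. (The empty partition has no smallest part, so it does not qualify.) -/
def HasUniqueSmallestOddBounded {N : ℕ} (p : N.Partition) : Prop :=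
  ∃ m ∈ p.parts, (∀ k ∈ p.parts, m ≤ k) ∧ p.parts.count m = 1 ∧
    ∀ k ∈ p.parts, Odd k → k < 2 * m

instance {N : ℕ} (p : N.Partition) : Decidable (HasUniqueSmallestOddBounded p) := by
  have : DecidablePred fun m : ℕ => (∀ k ∈ p.parts, m ≤ k) ∧ p.parts.count m = 1 ∧
      ∀ k ∈ p.parts, Odd k → k < 2 * m := fun m => by
    have : DecidablePred fun k : ℕ => (Odd k → k < 2 * m) := fun k => inferInstance
    have := Multiset.decidableForallMultiset (m := p.parts) (p := fun k => m ≤ k)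
    have := Multiset.decidableForallMultiset (m := p.parts) (p := fun k => (Odd k → k < 2 * m))
    infer_instance
  exact Multiset.decidableExistsMultiset

/-- The number of partitions of `N` with unique smallest part in which each odd part is less than
twice the smallest part. -/
def numUniqueSmallestOddBounded (N : ℕ) : ℕ :=
  (Finset.univ.filter fun p : N.Partition => HasUniqueSmallestOddBounded p).card

/-! Removing the smallest part m leaves parts among m+1, …, 2m and even parts ≥ 2m+2, counted by
1/((q^{m+1};q)_m (q^{2m+2};q²)_∞). Summing q^m times this over m ≥ 1 gives the first equality
(`hasSum_numUniqueSmallestOddBounded`).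

For the second, let P = (q²;q²)_∞ and F(w) = `oddSeries q w`. By `term_eq`, P times the series over
n ≥ 1 is F(q) - 1. A q-difference equation for F (`oddSeries_functional`), iterated along w = q, q²,
…, expresses F(q) through S = ∑ qⁿ/(q;q²)_n and an unwanted sum T = ∑ q^j (q;q)_j/(q;q²)_{j+2}
(`oddSeries_self_eq`). A separate telescoping evaluates F(q) + (1-q)²qT in closed form
(`oddSeries_self_add`). Adding the two relations cancels T, and (1-q)S - 1 is q² times the cubic
series (`sq_mul_tsum_cubic`). -/

open Filter Topology Finset

/-! ### Pochhammer symbols: splitting, nonvanishing, bounds -/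

theorem qPoch_add (a q : ℂ) (m n : ℕ) :
    qPoch a q (m + n) = qPoch a q m * qPoch (a * q ^ m) q n := by
  simp only [qPoch, Finset.prod_range_add, pow_add, mul_assoc]

theorem qPoch_succ (a q : ℂ) (n : ℕ) :
    qPoch a q (n + 1) = qPoch a q n * (1 - a * q ^ n) := by
  simp only [qPoch, Finset.prod_range_succ]

@[simp] theorem qPoch_zero (a q : ℂ) : qPoch a q 0 = 1 := by
  simp [qPoch]

theorem qPochInf_eq_mul (a q : ℂ) (hq : ‖q‖ < 1) (m : ℕ) :
    qPochInf a q = qPoch a q m * qPochInf (a * q ^ m) q := by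
  have h1 := (tendsto_qPoch a q hq).comp (tendsto_add_atTop_nat m)
  have h2 := (tendsto_qPoch (a * q ^ m) q hq).const_mul (qPoch a q m)
  refine tendsto_nhds_unique h1 (h2.congr fun n => ?_)
  rw [Function.comp_apply, Nat.add_comm n m, qPoch_add]

theorem one_sub_pow_ne_zero {q : ℂ} (hq : ‖q‖ < 1) {n : ℕ} (hn : n ≠ 0) : 1 - q ^ n ≠ 0 := by
  intro h
  have h1 : ‖q ^ n‖ < 1 := by
    rw [norm_pow]
    exact pow_lt_one₀ (norm_nonneg q) hq hn
  rw [← sub_eq_zero.mp h, norm_one] at h1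
  exact lt_irrefl _ h1

theorem norm_sq_lt_one {q : ℂ} (hq : ‖q‖ < 1) : ‖q ^ 2‖ < 1 := by
  rw [norm_pow]
  exact pow_lt_one₀ (norm_nonneg q) hq two_ne_zero

theorem one_sub_mul_pow_ne_zero {q : ℂ} (hq : ‖q‖ < 1) (k l i : ℕ) (hk : k ≠ 0) :
    1 - q ^ k * (q ^ l) ^ i ≠ 0 := by
  rw [← pow_mul, ← pow_add]
  exact one_sub_pow_ne_zero hq (by omega)

theorem qPoch_pow_ne_zero {q : ℂ} (hq : ‖q‖ < 1) {k : ℕ} (l : ℕ) (hk : k ≠ 0) (n : ℕ) :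
    qPoch (q ^ k) (q ^ l) n ≠ 0 :=
  Finset.prod_ne_zero_iff.mpr fun i _ => one_sub_mul_pow_ne_zero hq k l i hk

theorem qPoch_odd_ne_zero {q : ℂ} (hq : ‖q‖ < 1) (n : ℕ) : qPoch q (q ^ 2) n ≠ 0 := by
  simpa using qPoch_pow_ne_zero hq (k := 1) 2 one_ne_zero n

theorem qPochInf_odd_ne_zero {q : ℂ} (hq : ‖q‖ < 1) : qPochInf q (q ^ 2) ≠ 0 :=
  qPochInf_ne_zero _ _ (norm_sq_lt_one hq) fun i => by
    simpa using one_sub_mul_pow_ne_zero hq 1 2 i one_ne_zero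

theorem qPochInf_even_ne_zero {q : ℂ} (hq : ‖q‖ < 1) : qPochInf (q ^ 2) (q ^ 2) ≠ 0 :=
  qPochInf_ne_zero _ _ (norm_sq_lt_one hq) fun i =>
    one_sub_mul_pow_ne_zero hq 2 2 i two_ne_zero

/-- Splitting `(q; q)_{2n}` into its odd and its even factors. -/
theorem qPoch_two_mul (q : ℂ) (n : ℕ) :
    qPoch q q (2 * n) = qPoch q (q ^ 2) n * qPoch (q ^ 2) (q ^ 2) n := by
  induction n with
  | zero => simp
  | succ n ih =>
    rw [show 2 * (n + 1) = 2 * n + 1 + 1 by ring, qPoch_succ, qPoch_succ, ih, qPoch_succ,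
      qPoch_succ]
    ring

theorem qPochInf_split (q : ℂ) (hq : ‖q‖ < 1) :
    qPochInf q q = qPochInf q (q ^ 2) * qPochInf (q ^ 2) (q ^ 2) := by
  have h1 := (tendsto_qPoch q q hq).comp
    (tendsto_id.const_mul_atTop' (show 0 < 2 by norm_num) : Tendsto (fun n : ℕ => 2 * n) _ _)
  refine tendsto_nhds_unique h1 (((tendsto_qPoch q _ (norm_sq_lt_one hq)).mul
    (tendsto_qPoch (q ^ 2) _ (norm_sq_lt_one hq))).congr fun n => ?_)
  simp [qPoch_two_mul]

theorem norm_qPoch_le {a q : ℂ} (hq : ‖q‖ < 1) (ha : ‖a‖ ≤ 1) (n : ℕ) :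
    ‖qPoch a q n‖ ≤ Real.exp (1 - ‖q‖)⁻¹ := by
  have hs := summable_geometric_of_lt_one (norm_nonneg q) hq
  calc ‖qPoch a q n‖ = ∏ i ∈ range n, ‖1 - a * q ^ i‖ := by simp [qPoch]
    _ ≤ ∏ i ∈ range n, Real.exp (‖q‖ ^ i) := by
        refine Finset.prod_le_prod (fun _ _ => norm_nonneg _) fun i _ => ?_
        calc ‖1 - a * q ^ i‖ ≤ ‖(1 : ℂ)‖ + ‖a * q ^ i‖ := norm_sub_le _ _
          _ ≤ ‖q‖ ^ i + 1 := by
              rw [norm_one, norm_mul, norm_pow]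
              nlinarith [pow_nonneg (norm_nonneg q) i]
          _ ≤ _ := Real.add_one_le_exp _
    _ = Real.exp (∑ i ∈ range n, ‖q‖ ^ i) := (Real.exp_sum _ _).symm
    _ ≤ _ := by
        rw [← tsum_geometric_of_lt_one (norm_nonneg q) hq]
        exact Real.exp_le_exp.mpr (hs.sum_le_tsum _ fun i _ => by positivity)

theorem exists_norm_inv_qPoch_odd_le {q : ℂ} (hq : ‖q‖ < 1) :
    ∃ C : ℝ, ∀ n, ‖(qPoch q (q ^ 2) n)⁻¹‖ ≤ C := by
  have h := ((tendsto_qPoch q _ (norm_sq_lt_one hq)).inv₀ (qPochInf_odd_ne_zero hq)).norm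
  obtain ⟨C, hC⟩ := h.bddAbove_range
  exact ⟨C, fun n => hC ⟨n, rfl⟩⟩

/-- The ratios `(w; q)_n / (q; q²)_n` are bounded, uniformly in `n` and `‖w‖ ≤ 1`. -/
theorem exists_norm_term_le {q : ℂ} (hq : ‖q‖ < 1) :
    ∃ C : ℝ, ∀ w : ℂ, ‖w‖ ≤ 1 → ∀ n, ‖qPoch w q n / qPoch q (q ^ 2) n‖ ≤ C := by
  obtain ⟨C, hC⟩ := exists_norm_inv_qPoch_odd_le hq
  refine ⟨Real.exp (1 - ‖q‖)⁻¹ * C, fun w hw n => ?_⟩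
  rw [div_eq_mul_inv, norm_mul]
  exact mul_le_mul (norm_qPoch_le hq hw n) (hC n) (norm_nonneg _) (Real.exp_nonneg _)

theorem summable_pow_mul_of_norm_le {q : ℂ} (hq : ‖q‖ < 1) {f : ℕ → ℂ} {C : ℝ}
    (hf : ∀ n, ‖f n‖ ≤ C) : Summable fun n => q ^ n * f n := by
  refine Summable.of_norm_bounded
    ((summable_geometric_of_lt_one (norm_nonneg q) hq).mul_right C) fun n => ?_
  rw [norm_mul, norm_pow]
  exact mul_le_mul_of_nonneg_left (hf n) (by positivity)

theorem tsum_eq_sub_of_telescoping {f g : ℕ → ℂ} {L : ℂ} (hf : Summable f)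
    (hfg : ∀ n, f n = g (n + 1) - g n) (hg : Tendsto g atTop (𝓝 L)) :
    ∑' n, f n = L - g 0 := by
  refine tendsto_nhds_unique hf.hasSum.tendsto_sum_nat ((hg.sub_const (g 0)).congr fun n => ?_)
  rw [← Finset.sum_range_sub]
  exact Finset.sum_congr rfl fun i _ => (hfg i).symm

theorem tendsto_pow_zero {q : ℂ} (hq : ‖q‖ < 1) : Tendsto (fun n : ℕ => q ^ n) atTop (𝓝 0) :=
  tendsto_pow_atTop_nhds_zero_of_norm_lt_one hq

/-! ### The series F(w) and its q-difference equation -/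

/-- The series `∑ qⁿ (w; q)_n / (q; q²)_n`. -/
noncomputable def oddSeries (q w : ℂ) : ℂ :=
  ∑' n : ℕ, q ^ n * (qPoch w q n / qPoch q (q ^ 2) n)

theorem summable_oddSeries {q : ℂ} (hq : ‖q‖ < 1) {w : ℂ} (hw : ‖w‖ ≤ 1) :
    Summable fun n : ℕ => q ^ n * (qPoch w q n / qPoch q (q ^ 2) n) := by
  obtain ⟨C, hC⟩ := exists_norm_term_le hq
  exact summable_pow_mul_of_norm_le hq (hC w hw)

theorem one_sub_mul_qPoch_mul (w q : ℂ) (n : ℕ) :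
    (1 - w) * qPoch (q * w) q n = qPoch w q n * (1 - w * q ^ n) := by
  rw [← qPoch_succ, Nat.add_comm n 1, qPoch_add]
  simp [qPoch, mul_comm]

theorem odd_factor_ne_zero {q : ℂ} (hq : ‖q‖ < 1) (n : ℕ) : 1 - q * (q ^ 2) ^ n ≠ 0 := by
  simpa using one_sub_mul_pow_ne_zero hq 1 2 n one_ne_zero

theorem oddSeries_functional {q : ℂ} (hq : ‖q‖ < 1) {w : ℂ} (hw : ‖w‖ ≤ 1) :
    (1 - q * w ^ 2) * oddSeries q w = (1 - w) * oddSeries q (q * w) +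
      w * q * (qPochInf w q / qPochInf q (q ^ 2)) + w * (1 - q) := by
  have hqw : ‖q * w‖ ≤ 1 := by
    rw [norm_mul]; exact mul_le_one₀ hq.le (norm_nonneg _) hw
  have s1 := (summable_oddSeries hq hw).mul_left (1 - q * w ^ 2)
  have s2 := (summable_oddSeries hq hqw).mul_left (1 - w)
  -- The telescoping certificate: its limit supplies the infinite product, and its value w(q-1) at n
  -- = 0 supplies the term w(1-q).
  have hlim : Tendsto (fun n : ℕ => w * (q - (q ^ 2) ^ n) *
      (qPoch w q n / qPoch q (q ^ 2) n)) atTop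
      (𝓝 (w * (q - 0) * (qPochInf w q / qPochInf q (q ^ 2)))) :=
    ((tendsto_const_nhds.sub (tendsto_pow_zero (norm_sq_lt_one hq))).const_mul w).mul
      ((tendsto_qPoch w q hq).div (tendsto_qPoch q _ (norm_sq_lt_one hq))
        (qPochInf_odd_ne_zero hq))
  have key := tsum_eq_sub_of_telescoping (s1.sub s2) (fun n => ?_) hlim
  · rw [s1.tsum_sub s2, tsum_mul_left, tsum_mul_left] at key
    simp only [oddSeries]
    simp only [qPoch_zero] at key
    linear_combination key
  · have h1 := qPoch_odd_ne_zero hq n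
    have h2 := odd_factor_ne_zero hq n
    have h3 : (1 - w) * (q ^ n * (qPoch (q * w) q n / qPoch q (q ^ 2) n)) =
        q ^ n * (qPoch w q n * (1 - w * q ^ n) / qPoch q (q ^ 2) n) := by
      rw [← one_sub_mul_qPoch_mul]; ring
    rw [h3, qPoch_succ, qPoch_succ]
    have h4 : (q ^ 2) ^ n = q ^ n * q ^ n := by rw [← pow_mul, two_mul, pow_add]
    rw [pow_succ (q ^ 2) n]
    rw [h4] at h2 ⊢
    generalize q ^ n = x at h2 ⊢
    rw [← sq] at h2
    field_simp
    ring

/-- As w → 0 each (w;q)_n tends to 1; the bound uniform in w lets the limit pass through the sum. -/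
theorem tendsto_oddSeries_pow {q : ℂ} (hq : ‖q‖ < 1) :
    Tendsto (fun j : ℕ => oddSeries q (q ^ (j + 1))) atTop
      (𝓝 (∑' n : ℕ, q ^ n * (1 / qPoch q (q ^ 2) n))) := by
  obtain ⟨C, hC⟩ := exists_norm_term_le hq
  refine tendsto_tsum_of_dominated_convergence
    ((summable_geometric_of_lt_one (norm_nonneg q) hq).mul_right C) (fun n => ?_) ?_
  · have h : Tendsto (fun j : ℕ => qPoch (q ^ (j + 1)) q n) atTop
        (𝓝 (∏ i ∈ range n, (1 - 0 * q ^ i))) :=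
      tendsto_finsetProd _ fun i _ => tendsto_const_nhds.sub
        (((tendsto_pow_zero hq).comp (tendsto_add_atTop_nat 1)).mul_const _)
    simp only [zero_mul, sub_zero, prod_const_one] at h
    exact (h.div_const _).const_mul _
  · refine Eventually.of_forall fun j n => ?_
    rw [norm_mul, norm_pow]
    refine mul_le_mul_of_nonneg_left (hC _ ?_ n) (by positivity)
    rw [norm_pow]
    exact pow_le_one₀ (norm_nonneg q) hq.le

theorem summable_pow_div_qPoch_odd {q : ℂ} (hq : ‖q‖ < 1) (k : ℕ) :
    Summable fun n : ℕ => q ^ n * (1 / qPoch q (q ^ 2) (n + k)) := by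
  obtain ⟨C, hC⟩ := exists_norm_inv_qPoch_odd_le hq
  exact summable_pow_mul_of_norm_le hq (C := C) fun n => by simpa using hC (n + k)

theorem summable_qPoch_div_qPoch_odd {q : ℂ} (hq : ‖q‖ < 1) :
    Summable fun j : ℕ => q ^ j * (qPoch q q j / qPoch q (q ^ 2) (j + 2)) := by
  obtain ⟨C, hC⟩ := exists_norm_inv_qPoch_odd_le hq
  refine summable_pow_mul_of_norm_le hq (C := Real.exp (1 - ‖q‖)⁻¹ * C) fun n => ?_
  rw [div_eq_mul_inv, norm_mul]
  exact mul_le_mul (norm_qPoch_le hq hq.le n) (hC _) (norm_nonneg _) (Real.exp_nonneg _)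

/-- Iterating the functional equation of `oddSeries` from `w = q`. -/
theorem oddSeries_self_eq {q : ℂ} (hq : ‖q‖ < 1) :
    oddSeries q q =
      (1 - q) * qPochInf (q ^ 2) (q ^ 2) * ∑' n : ℕ, q ^ n * (1 / qPoch q (q ^ 2) n) +
      qPochInf (q ^ 2) (q ^ 2) * ((1 - q) * q ^ 2) *
        ∑' j : ℕ, q ^ j * (1 / qPoch q (q ^ 2) (j + 2)) +
      (1 - q) ^ 2 * q * ∑' j : ℕ, q ^ j * (qPoch q q j / qPoch q (q ^ 2) (j + 2)) := by
  have hO := qPochInf_odd_ne_zero hq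
  have s1 := (summable_pow_div_qPoch_odd hq 2).mul_left
    (-(qPochInf (q ^ 2) (q ^ 2) * ((1 - q) * q ^ 2)))
  have s2 := (summable_qPoch_div_qPoch_odd hq).mul_left ((1 - q) ^ 2 * q)
  -- The weight is the product of the ratios (1-w)/(1-qw²) over w = q, …, q^j, so the homogeneous
  -- part of the functional equation telescopes.
  have hlim : Tendsto (fun j : ℕ => (1 - q) * (qPoch q q j / qPoch q (q ^ 2) (j + 1)) *
      oddSeries q (q ^ (j + 1))) atTop
      (𝓝 ((1 - q) * (qPochInf q q / qPochInf q (q ^ 2)) *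
        ∑' n : ℕ, q ^ n * (1 / qPoch q (q ^ 2) n))) :=
    (((tendsto_qPoch q q hq).div ((tendsto_qPoch q _ (norm_sq_lt_one hq)).comp
      (tendsto_add_atTop_nat 1)) hO).const_mul _).mul (tendsto_oddSeries_pow hq)
  have key := tsum_eq_sub_of_telescoping (s1.sub s2) (fun j => ?_) hlim
  · have h0 : 1 - q ≠ 0 := by simpa using one_sub_pow_ne_zero hq one_ne_zero
    rw [s1.tsum_sub s2, tsum_mul_left, tsum_mul_left, qPochInf_split q hq,
      mul_div_cancel_left₀ _ hO] at key
    have hD : qPoch q (q ^ 2) 1 = 1 - q := by simp [qPoch]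
    simp only [qPoch_zero, zero_add, pow_one, hD, mul_one_div_cancel h0, one_mul] at key
    linear_combination key
  · have hw : ‖q ^ (j + 1)‖ ≤ 1 := by
      rw [norm_pow]; exact pow_le_one₀ (norm_nonneg q) hq.le
    have hf := oddSeries_functional hq hw
    have h1 := qPoch_odd_ne_zero hq (j + 1)
    have h2 := odd_factor_ne_zero hq (j + 1)
    -- After weighting, the infinite product in the inhomogeneous term no longer depends on j.
    have hP : qPoch q q j * (qPochInf (q ^ (j + 1)) q / qPochInf q (q ^ 2)) =
        qPochInf (q ^ 2) (q ^ 2) := by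
      have := qPochInf_eq_mul q q hq j
      rw [← pow_succ'] at this
      rw [← mul_div_assoc, ← this, qPochInf_split q hq, mul_div_cancel_left₀ _ hO]
    rw [← pow_succ'] at hf
    have h4 : q * (q ^ 2) ^ (j + 1) = q * (q ^ (j + 1)) ^ 2 := by
      rw [← pow_mul, ← pow_mul, mul_comm 2]
    have h5 : q * q ^ j = q ^ (j + 1) := (pow_succ' q j).symm
    rw [show j + 2 = j + 1 + 1 from rfl, qPoch_succ _ _ (j + 1), qPoch_succ q q j, h4, h5]
    rw [h4] at h2
    generalize oddSeries q (q ^ (j + 1)) = A at hf ⊢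
    generalize oddSeries q (q ^ (j + 1 + 1)) = B at hf ⊢
    generalize qPochInf (q ^ (j + 1)) q / qPochInf q (q ^ 2) = E at hf hP
    rw [← hP]
    generalize q ^ (j + 1) = y at *
    field_simp
    linear_combination ((1 - q) * qPoch q q j) * hf +
      (qPoch q q j * (-1 + 2 * q - q * E - q ^ 2 + q ^ 2 * E)) * h5

/-! ### A second relation, and the closed form of F(q) -/

theorem tendsto_qPoch_ratio {q : ℂ} (hq : ‖q‖ < 1) :
    Tendsto (fun n : ℕ => qPoch q q n / qPoch q (q ^ 2) n) atTop
      (𝓝 (qPochInf (q ^ 2) (q ^ 2))) := by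
  have h := (tendsto_qPoch q q hq).div (tendsto_qPoch q _ (norm_sq_lt_one hq))
    (qPochInf_odd_ne_zero hq)
  rwa [qPochInf_split q hq, mul_div_cancel_left₀ _ (qPochInf_odd_ne_zero hq)] at h

theorem oddSeries_self_add {q : ℂ} (hq : ‖q‖ < 1) :
    oddSeries q q +
      (1 - q) ^ 2 * q * ∑' j : ℕ, q ^ j * (qPoch q q j / qPoch q (q ^ 2) (j + 2)) =
      2 + 2 * q - qPochInf (q ^ 2) (q ^ 2) := by
  have s1 := summable_oddSeries hq hq.le
  have s2 := (summable_qPoch_div_qPoch_odd hq).mul_left ((1 - q) ^ 2 * q)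
  have hx := tendsto_pow_zero hq
  -- A certificate rational in qⁿ: it equals -2(1+q) at n = 0 and tends to -P, where P = (q²;q²)_∞.
  have hlim : Tendsto (fun n : ℕ => qPoch q q n / qPoch q (q ^ 2) n *
      ((-1 + (-1 - q + q ^ 2) * q ^ n + q ^ 2 * (q ^ n) ^ 2 + q * (q ^ n) ^ 3) /
        (1 - q * (q ^ n) ^ 2))) atTop
      (𝓝 (qPochInf (q ^ 2) (q ^ 2) *
        ((-1 + (-1 - q + q ^ 2) * 0 + q ^ 2 * 0 ^ 2 + q * 0 ^ 3) / (1 - q * 0 ^ 2)))) :=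
    (tendsto_qPoch_ratio hq).mul (((((hx.const_mul _).const_add _).add
      ((hx.pow 2).const_mul _)).add ((hx.pow 3).const_mul _)).div
      (((hx.pow 2).const_mul _).const_sub _) (by simp))
  have h0 : 1 - q ≠ 0 := by simpa using one_sub_pow_ne_zero hq one_ne_zero
  have key := tsum_eq_sub_of_telescoping (s1.add s2) (fun n => ?_) hlim
  · rw [s1.tsum_add s2, tsum_mul_left] at key
    rw [oddSeries, key]
    simp only [qPoch_zero, pow_zero, one_pow, mul_one]
    field_simp
    ring
  · have h1 := qPoch_odd_ne_zero hq n
    have h2 := odd_factor_ne_zero hq n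
    have h3 := odd_factor_ne_zero hq (n + 1)
    rw [qPoch_succ _ _ (n + 1), qPoch_succ _ _ n, qPoch_succ _ _ n]
    have h4 : (q ^ 2) ^ n = (q ^ n) ^ 2 := by rw [← pow_mul, ← pow_mul, mul_comm]
    rw [pow_succ (q ^ 2) n, h4] at h3
    rw [h4] at h2
    rw [pow_succ (q ^ 2) n, h4, pow_succ q n]
    generalize q ^ n = x at *
    have h5 : 1 - q ^ 3 * x ^ 2 ≠ 0 := by
      intro h; apply h3; linear_combination h
    rw [show 1 - q * (x * q) ^ 2 = 1 - q ^ 3 * x ^ 2 by ring,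
      show 1 - q * (x ^ 2 * q ^ 2) = 1 - q ^ 3 * x ^ 2 by ring]
    generalize hu : 1 - q * x ^ 2 = u at *
    generalize hv : 1 - q ^ 3 * x ^ 2 = v at *
    field_simp
    rw [← hu, ← hv]
    ring

theorem summable_cubic {q : ℂ} (hq : ‖q‖ < 1) :
    Summable fun m : ℕ => q ^ (3 * m) / qPoch q (q ^ 2) (m + 1) := by
  obtain ⟨C, hC⟩ := exists_norm_inv_qPoch_odd_le hq
  have h3 : ‖q ^ 3‖ < 1 := by
    rw [norm_pow]; exact pow_lt_one₀ (norm_nonneg q) hq three_ne_zero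
  simpa only [pow_mul, div_eq_mul_inv] using
    summable_pow_mul_of_norm_le h3 (fun n => hC (n + 1))

theorem sq_mul_tsum_cubic {q : ℂ} (hq : ‖q‖ < 1) :
    q ^ 2 * ∑' m : ℕ, q ^ (3 * m) / qPoch q (q ^ 2) (m + 1) =
      (1 - q) * (∑' n : ℕ, q ^ n * (1 / qPoch q (q ^ 2) n)) - 1 := by
  have s1 := (summable_cubic hq).mul_left (q ^ 2)
  have s2 := (summable_pow_div_qPoch_odd hq 0).mul_left (1 - q)
  simp only [add_zero] at s2
  -- The certificate is qⁿ/(q;q²)_n itself, which goes from 1 to 0.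
  have key := tsum_eq_sub_of_telescoping (s1.sub s2) (fun n => ?_)
    (summable_pow_div_qPoch_odd hq 0).tendsto_atTop_zero
  · rw [s1.tsum_sub s2, tsum_mul_left, tsum_mul_left] at key
    simp only [add_zero, qPoch_zero, pow_zero] at key
    linear_combination key
  · have h1 := qPoch_odd_ne_zero hq n
    have h2 := odd_factor_ne_zero hq n
    simp only [add_zero]
    rw [qPoch_succ, pow_succ q n, pow_mul', show (q ^ 2) ^ n = (q ^ n) ^ 2 by
      rw [← pow_mul, ← pow_mul, mul_comm]]
    rw [show (q ^ 2) ^ n = (q ^ n) ^ 2 by rw [← pow_mul, ← pow_mul, mul_comm]] at h2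
    generalize q ^ n = x at *
    field_simp
    ring

/-- The two terms missing from the shifted sum are 1 and q/(1-q), which add up to 1/(1-q). -/
theorem tsum_shift_two {q : ℂ} (hq : ‖q‖ < 1) :
    (1 - q) * q ^ 2 * ∑' j : ℕ, q ^ j * (1 / qPoch q (q ^ 2) (j + 2)) =
      (1 - q) * (∑' n : ℕ, q ^ n * (1 / qPoch q (q ^ 2) n)) - 1 := by
  have h0 : 1 - q ≠ 0 := by simpa using one_sub_pow_ne_zero hq one_ne_zero
  have h := (summable_pow_div_qPoch_odd hq 0).sum_add_tsum_nat_add 2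
  have hD : qPoch q (q ^ 2) 1 = 1 - q := by simp [qPoch]
  simp only [add_zero, Finset.sum_range_succ, Finset.sum_range_zero, qPoch_zero, hD, pow_add,
    mul_right_comm _ (q ^ 2) _, tsum_mul_right, pow_zero, pow_one, zero_add, one_mul] at h
  rw [← h]
  field_simp
  ring

theorem oddSeries_self {q : ℂ} (hq : ‖q‖ < 1) :
    oddSeries q q = 1 + q + qPochInf (q ^ 2) (q ^ 2) *
      (q ^ 2 * ∑' m : ℕ, q ^ (3 * m) / qPoch q (q ^ 2) (m + 1)) := by
  have h1 := oddSeries_self_eq hq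
  have h2 := oddSeries_self_add hq
  have h3 := tsum_shift_two hq
  rw [sq_mul_tsum_cubic hq]
  linear_combination (h1 + h2 + qPochInf (q ^ 2) (q ^ 2) * h3) / 2

/-- Uses (q^{n+1};q)_n = (q;q)_{2n}/(q;q)_n with (q;q)_{2n} = (q;q²)_n (q²;q²)_n; the factor
(q²;q²)_n completes the infinite product. -/
theorem term_eq {q : ℂ} (hq : ‖q‖ < 1) (n : ℕ) :
    q ^ n / (qPoch (q ^ (n + 1)) q n * qPochInf (q ^ (2 * n + 2)) (q ^ 2)) =
      q ^ n * (qPoch q q n / qPoch q (q ^ 2) n) / qPochInf (q ^ 2) (q ^ 2) := by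
  have hP := qPochInf_even_ne_zero hq
  have hD := qPoch_odd_ne_zero hq n
  have hE := qPoch_pow_ne_zero hq 2 two_ne_zero n
  have h1 := qPochInf_eq_mul (q ^ 2) (q ^ 2) (norm_sq_lt_one hq) n
  have h2 := qPoch_add q q n n
  rw [← two_mul, qPoch_two_mul, ← pow_succ'] at h2
  rw [← pow_mul, ← pow_add, add_comm 2] at h1
  have hA : qPoch (q ^ (n + 1)) q n ≠ 0 := by
    simpa using qPoch_pow_ne_zero hq 1 n.succ_ne_zero n
  have hB : qPochInf (q ^ (2 * n + 2)) (q ^ 2) ≠ 0 := by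
    intro h; rw [h, mul_zero] at h1; exact hP h1
  rw [div_eq_div_iff (mul_ne_zero hA hB) hP, mul_div_assoc', div_mul_eq_mul_div,
    eq_div_iff hD]
  rw [← mul_right_inj' hE]
  rw [h1]
  linear_combination (q ^ n * qPoch (q ^ 2) (q ^ 2) n * qPochInf (q ^ (2 * n + 2)) (q ^ 2)) * h2

theorem summable_term {q : ℂ} (hq : ‖q‖ < 1) : Summable fun n : ℕ =>
    q ^ n / (qPoch (q ^ (n + 1)) q n * qPochInf (q ^ (2 * n + 2)) (q ^ 2)) := by
  simp only [term_eq hq]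
  exact (summable_oddSeries hq hq.le).div_const _

theorem tsum_term {q : ℂ} (hq : ‖q‖ < 1) :
    ∑' n : ℕ+, q ^ (n : ℕ) /
        (qPoch (q ^ ((n : ℕ) + 1)) q n * qPochInf (q ^ (2 * (n : ℕ) + 2)) (q ^ 2)) =
      q ^ 2 * (∑' m : ℕ, q ^ (3 * m) / qPoch q (q ^ 2) (m + 1)) +
        q / qPochInf (q ^ 2) (q ^ 2) := by
  have hP := qPochInf_even_ne_zero hq
  -- The n = 0 term is 1/(q²;q²)_∞; subtracting it turns the numerator 1 + q into q.
  have h := tsum_zero_pnat_eq_tsum_nat (summable_term hq)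
  have h2 : ∑' n : ℕ, q ^ n / (qPoch (q ^ (n + 1)) q n * qPochInf (q ^ (2 * n + 2)) (q ^ 2)) =
      oddSeries q q / qPochInf (q ^ 2) (q ^ 2) := by
    simp only [term_eq hq, tsum_div_const, oddSeries]
  rw [h2, oddSeries_self hq] at h
  simp only [pow_zero, qPoch_zero, one_mul, mul_zero, zero_add] at h
  rw [eq_sub_of_add_eq' h]
  field_simp
  ring


/-! ### Evaluating formal power series at a point -/

theorem hasSum_antidiagonal_mul {𝕜 : Type*} [NormedField 𝕜] [CompleteSpace 𝕜] {a b : ℕ → 𝕜}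
    {q x y : 𝕜} (ha : Summable fun n => ‖a n * q ^ n‖) (hb : Summable fun n => ‖b n * q ^ n‖)
    (hx : HasSum (fun n => a n * q ^ n) x) (hy : HasSum (fun n => b n * q ^ n) y) :
    (Summable fun n => ‖(∑ p ∈ antidiagonal n, a p.1 * b p.2) * q ^ n‖) ∧
      HasSum (fun n => (∑ p ∈ antidiagonal n, a p.1 * b p.2) * q ^ n) (x * y) := by
  have e : ∀ n, (∑ p ∈ antidiagonal n, a p.1 * b p.2) * q ^ n =
      ∑ p ∈ antidiagonal n, (a p.1 * q ^ p.1) * (b p.2 * q ^ p.2) := fun n => by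
    rw [Finset.sum_mul]
    refine Finset.sum_congr rfl fun p hp => ?_
    rw [← mem_antidiagonal.mp hp, pow_add]
    ring
  simp only [e]
  have s := summable_norm_sum_mul_antidiagonal_of_summable_norm ha hb
  refine ⟨s, ?_⟩
  rw [← hx.tsum_eq, ← hy.tsum_eq, tsum_mul_tsum_eq_tsum_sum_antidiagonal_of_summable_norm ha hb]
  exact s.of_norm.hasSum

/-- The power series `f` converges absolutely at `q`, with sum `v`. -/
def PowerSeries.EvalsTo {𝕜 : Type*} [NormedField 𝕜] (f : PowerSeries 𝕜) (q v : 𝕜) : Prop :=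
  (Summable fun n => ‖PowerSeries.coeff n f * q ^ n‖) ∧
    HasSum (fun n => PowerSeries.coeff n f * q ^ n) v

namespace PowerSeries.EvalsTo

variable {𝕜 : Type*} [NormedField 𝕜] {q : 𝕜}

theorem one : EvalsTo (1 : PowerSeries 𝕜) q 1 := by
  have h : ∀ n, n ≠ 0 → PowerSeries.coeff n (1 : PowerSeries 𝕜) * q ^ n = 0 := fun n hn => by
    simp [PowerSeries.coeff_one, hn]
  refine ⟨summable_of_ne_finset_zero (s := {0}) fun n hn => ?_, ?_⟩
  · rw [h n (by simpa using hn), norm_zero]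
  · simpa using hasSum_single 0 h

theorem mul [CompleteSpace 𝕜] {f g : PowerSeries 𝕜} {x y : 𝕜} (hf : EvalsTo f q x)
    (hg : EvalsTo g q y) : EvalsTo (f * g) q (x * y) := by
  simpa only [EvalsTo, PowerSeries.coeff_mul] using
    hasSum_antidiagonal_mul hf.1 hg.1 hf.2 hg.2

theorem prod [CompleteSpace 𝕜] {ι : Type*} (s : Finset ι) {f : ι → PowerSeries 𝕜} {v : ι → 𝕜}
    (h : ∀ i ∈ s, EvalsTo (f i) q (v i)) : EvalsTo (∏ i ∈ s, f i) q (∏ i ∈ s, v i) := by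
  classical
  induction s using Finset.induction_on with
  | empty => simpa using one
  | insert i s hi ih =>
    rw [Finset.prod_insert hi, Finset.prod_insert hi]
    exact (h i (mem_insert_self i s)).mul (ih fun j hj => h j (mem_insert_of_mem hj))

end PowerSeries.EvalsTo

open scoped PowerSeries.WithPiTopology in
theorem coeff_tsum_X_pow {R : Type*} [CommSemiring R] [TopologicalSpace R] [T2Space R]
    [IsTopologicalSemiring R] (i n : ℕ) :
    PowerSeries.coeff n (∑' j : ℕ, (PowerSeries.X : PowerSeries R) ^ ((i + 1) * j)) =
      if (i + 1) ∣ n then 1 else 0 := by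
  have hs : Summable fun j : ℕ => (PowerSeries.X : PowerSeries R) ^ ((i + 1) * j) := by
    simp_rw [pow_mul]
    exact PowerSeries.WithPiTopology.summable_pow_of_constantCoeff_eq_zero (by simp)
  rw [hs.map_tsum _ (PowerSeries.WithPiTopology.continuous_coeff R n)]
  simp only [PowerSeries.coeff_X_pow]
  split_ifs with h
  · obtain ⟨k, rfl⟩ := h
    rw [tsum_eq_single k]
    · simp
    · intro b hb
      rw [if_neg]
      simpa using fun h => hb h.symm
  · refine (tsum_congr fun j => if_neg ?_).trans tsum_zero
    rintro rfl
    exact h ⟨j, rfl⟩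

open scoped PowerSeries.WithPiTopology in
theorem evalsTo_tsum_X_pow {𝕜 : Type*} [NormedField 𝕜] [CompleteSpace 𝕜] {q : 𝕜} (hq : ‖q‖ < 1)
    (i : ℕ) :
    PowerSeries.EvalsTo (∑' j : ℕ, (PowerSeries.X : PowerSeries 𝕜) ^ ((i + 1) * j)) q
      (1 - q ^ (i + 1))⁻¹ := by
  have hq' : ‖q ^ (i + 1)‖ < 1 := by
    rw [norm_pow]
    exact pow_lt_one₀ (norm_nonneg q) hq i.succ_ne_zero
  have hinj : Function.Injective fun j : ℕ => (i + 1) * j :=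
    fun a b h => Nat.eq_of_mul_eq_mul_left i.succ_pos h
  have hz : ∀ n ∉ Set.range fun j : ℕ => (i + 1) * j,
      ((if (i + 1) ∣ n then 1 else 0) * q ^ n : 𝕜) = 0 := fun n hn => by
    rw [if_neg, zero_mul]
    rintro ⟨j, rfl⟩
    exact hn ⟨j, rfl⟩
  simp only [PowerSeries.EvalsTo, coeff_tsum_X_pow]
  constructor
  · rw [← hinj.summable_iff fun n hn => by rw [hz n hn, norm_zero]]
    have := summable_geometric_of_lt_one (norm_nonneg _) hq'
    simpa [Function.comp_def, pow_mul] using this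
  · rw [← hinj.hasSum_iff hz]
    simpa [Function.comp_def, pow_mul] using hasSum_geometric_of_norm_lt_one hq'

/-! ### Analytic generating functions of restricted partitions -/

open Nat.Partition

theorem card_restricted_congr {n : ℕ} {S T : ℕ → Prop} [DecidablePred S] [DecidablePred T]
    (h : ∀ k ≤ n, (S k ↔ T k)) : #(restricted n S) = #(restricted n T) := by
  congr 1
  ext p
  simp only [restricted, mem_filter, mem_univ, true_and]
  exact forall₂_congr fun k hk => h k (le_of_mem_parts hk)

/-- Generating function of the partitions with parts in `S`, all at most `M`. -/
theorem evalsTo_card_restricted_le {𝕜 : Type*} [NormedField 𝕜] [CompleteSpace 𝕜] {q : 𝕜}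
    (hq : ‖q‖ < 1) (S : ℕ → Prop) [DecidablePred S] (M : ℕ) :
    PowerSeries.EvalsTo (PowerSeries.mk fun n => (#(restricted n fun k => S k ∧ k ≤ M) : 𝕜)) q
      (∏ i ∈ range M, if S (i + 1) then (1 - q ^ (i + 1))⁻¹ else 1) := by
  open scoped PowerSeries.WithPiTopology in
  have h := hasProd_powerSeriesMk_card_restricted 𝕜 fun k => S k ∧ k ≤ M
  -- The bound k ≤ M makes the formal product finite, so it can be evaluated factor by factor.
  have h2 := h.unique (hasProd_prod_of_ne_finset_one (s := range M) fun i hi => if_neg fun hc =>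
    hi (mem_range.mpr hc.2))
  rw [h2]
  refine PowerSeries.EvalsTo.prod _ fun i hi => ?_
  have hi' : i + 1 ≤ M := mem_range.mp hi
  simp only [hi', and_true]
  split_ifs
  · exact evalsTo_tsum_X_pow hq i
  · exact PowerSeries.EvalsTo.one

/-- With x = r^{i+1} ≤ r, 1/(1-x) = 1 + x/(1-x) ≤ exp(x/(1-r)), and these exponents are summable. -/
theorem exists_prod_inv_one_sub_pow_le {r : ℝ} (h0 : 0 ≤ r) (h1 : r < 1) (S : ℕ → Prop)
    [DecidablePred S] : ∃ C : ℝ, ∀ M,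
      ∏ i ∈ range M, (if S (i + 1) then (1 - r ^ (i + 1))⁻¹ else 1) ≤ C := by
  have hpos : ∀ i : ℕ, 0 < 1 - r ^ (i + 1) := fun i =>
    sub_pos.mpr (pow_lt_one₀ h0 h1 i.succ_ne_zero)
  have hs := ((summable_geometric_of_lt_one h0 h1).mul_right (r * (1 - r)⁻¹))
  refine ⟨Real.exp (∑' i : ℕ, r ^ i * (r * (1 - r)⁻¹)), fun M => ?_⟩
  calc ∏ i ∈ range M, (if S (i + 1) then (1 - r ^ (i + 1))⁻¹ else 1)
      ≤ ∏ i ∈ range M, Real.exp (r ^ i * (r * (1 - r)⁻¹)) := by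
        refine Finset.prod_le_prod (fun i _ => ?_) fun i _ => ?_
        · split_ifs
          · exact inv_nonneg.mpr (hpos i).le
          · exact zero_le_one
        · have hr : 0 < 1 - r := sub_pos.mpr h1
          have hx : 0 ≤ r ^ i * (r * (1 - r)⁻¹) := by positivity
          split_ifs
          · refine le_trans ?_ (Real.add_one_le_exp _)
            rw [inv_le_iff_one_le_mul₀ (hpos i)]
            have hle : r ^ (i + 1) ≤ r := by
              simpa using pow_le_pow_of_le_one h0 h1.le (Nat.le_add_left 1 i)
            have h2 : r ^ i * (r * (1 - r)⁻¹) * (1 - r) = r ^ (i + 1) := by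
              field_simp
              exact (pow_succ r i).symm
            nlinarith
          · exact Real.one_le_exp hx
    _ = Real.exp (∑ i ∈ range M, r ^ i * (r * (1 - r)⁻¹)) := (Real.exp_sum _ _).symm
    _ ≤ _ := Real.exp_le_exp.mpr (hs.sum_le_tsum _ fun i _ => by
        have hr : 0 < 1 - r := sub_pos.mpr h1
        positivity)

theorem summable_card_restricted_mul_pow {r : ℝ} (h0 : 0 ≤ r) (h1 : r < 1) (S : ℕ → Prop)
    [DecidablePred S] : Summable fun n => (#(restricted n S) : ℝ) * r ^ n := by
  obtain ⟨C, hC⟩ := exists_prod_inv_one_sub_pow_le h0 h1 S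
  refine summable_of_sum_range_le (c := C) (fun n => by positivity) fun M => le_trans ?_ (hC M)
  have h := (evalsTo_card_restricted_le (by rwa [Real.norm_of_nonneg h0]) S M).2
  simp only [PowerSeries.coeff_mk] at h
  -- For n < M the restriction to parts ≤ M is vacuous, so the truncated product dominates the
  -- partial sum.
  refine le_trans (Finset.sum_le_sum fun n hn => ?_)
    (sum_le_hasSum (range M) (fun n _ => by positivity) h)
  rw [card_restricted_congr (T := fun k => S k ∧ k ≤ M)]
  intro k hk
  simp [hk.trans (mem_range.mp hn).le]

/-- Generating function of the partitions with parts in `S`, as a limit of finite products. -/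
theorem tendsto_prod_restricted {q : ℂ} (hq : ‖q‖ < 1) (S : ℕ → Prop) [DecidablePred S] :
    Tendsto (fun M => ∏ i ∈ range M, if S (i + 1) then (1 - q ^ (i + 1))⁻¹ else 1) atTop
      (𝓝 (∑' n : ℕ, (#(restricted n S) : ℂ) * q ^ n)) := by
  have h : ∀ M, ∑' n : ℕ, (#(restricted n fun k => S k ∧ k ≤ M) : ℂ) * q ^ n =
      ∏ i ∈ range M, if S (i + 1) then (1 - q ^ (i + 1))⁻¹ else 1 := fun M => by
    have := (evalsTo_card_restricted_le hq S M).2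
    simp only [PowerSeries.coeff_mk] at this
    exact this.tsum_eq
  simp only [← h]
  refine tendsto_tsum_of_dominated_convergence
    (summable_card_restricted_mul_pow (norm_nonneg q) hq S) (fun n => ?_) ?_
  -- Each coefficient is stationary once M ≥ n.
  · refine tendsto_atTop_of_eventually_const (i₀ := n) fun M hM => ?_
    rw [card_restricted_congr (S := S) (T := fun k => S k ∧ k ≤ M)]
    intro k hk
    simp [hk.trans hM]
  · refine Eventually.of_forall fun M n => ?_
    rw [norm_mul, norm_pow, Complex.norm_natCast]
    refine mul_le_mul_of_nonneg_right ?_ (by positivity)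
    refine Nat.cast_le.mpr (Finset.card_le_card fun p hp => ?_)
    simp only [restricted, mem_filter, mem_univ, true_and] at hp ⊢
    exact fun k hk => (hp k hk).1

/-! ### Removing the smallest part -/

/-- The parts allowed besides a smallest part `m` that occurs once. -/
def AllowedAbove (m k : ℕ) : Prop := m < k ∧ (Odd k → k < 2 * m)

instance (m : ℕ) : DecidablePred (AllowedAbove m) := fun k =>
  inferInstanceAs (Decidable (m < k ∧ (Odd k → k < 2 * m)))

theorem prod_allowedAbove (q : ℂ) (m L : ℕ) :
    (∏ i ∈ range (m + (m + 2 * L)), if AllowedAbove m (i + 1) then (1 - q ^ (i + 1))⁻¹ else 1) =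
      (qPoch (q ^ (m + 1)) q m * qPoch (q ^ (2 * m + 2)) (q ^ 2) L)⁻¹ := by
  -- Index i stands for the part i+1: parts 1..m are excluded, m+1..2m all allowed, and beyond 2m
  -- only the even ones.
  rw [prod_range_add, prod_range_add]
  have h1 : ∏ i ∈ range m, (if AllowedAbove m (i + 1) then (1 - q ^ (i + 1))⁻¹ else 1) = 1 :=
    prod_eq_one fun i hi => if_neg fun h => by
      have := h.1
      have := mem_range.mp hi
      omega
  have h2 : ∏ i ∈ range m, (if AllowedAbove m (m + i + 1) then (1 - q ^ (m + i + 1))⁻¹ else 1) =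
      (qPoch (q ^ (m + 1)) q m)⁻¹ := by
    rw [qPoch, ← prod_inv_distrib]
    refine prod_congr rfl fun i hi => ?_
    have := mem_range.mp hi
    rw [if_pos, ← pow_add, Nat.add_right_comm]
    refine ⟨by omega, ?_⟩
    rintro ⟨k, hk⟩
    omega
  have h3 : ∏ i ∈ range (2 * L), (if AllowedAbove m (m + (m + i) + 1) then
      (1 - q ^ (m + (m + i) + 1))⁻¹ else 1) = (qPoch (q ^ (2 * m + 2)) (q ^ 2) L)⁻¹ := by
    induction L with
    | zero => simp
    | succ L ih =>
      rw [show 2 * (L + 1) = 2 * L + 1 + 1 by ring, prod_range_succ, prod_range_succ, ih, qPoch_succ,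
        if_neg, if_pos, mul_one, mul_inv, ← pow_mul, ← pow_add]
      · congr 4
        ring
      · refine ⟨by omega, ?_⟩
        rintro ⟨k, hk⟩
        omega
      · intro h
        have := h.2 ⟨m + L, by ring⟩
        omega
  rw [h1, h2, h3, one_mul, mul_inv]

theorem tsum_card_restricted_allowedAbove {q : ℂ} (hq : ‖q‖ < 1) (m : ℕ) :
    ∑' n : ℕ, (#(restricted n (AllowedAbove m)) : ℂ) * q ^ n =
      (qPoch (q ^ (m + 1)) q m * qPochInf (q ^ (2 * m + 2)) (q ^ 2))⁻¹ := by
  have hA : qPoch (q ^ (m + 1)) q m ≠ 0 := by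
    simpa using qPoch_pow_ne_zero hq 1 m.succ_ne_zero m
  have hB : qPochInf (q ^ (2 * m + 2)) (q ^ 2) ≠ 0 :=
    qPochInf_ne_zero _ _ (norm_sq_lt_one hq) fun i =>
      one_sub_mul_pow_ne_zero hq _ 2 i (by omega)
  have hsub : Tendsto (fun L : ℕ => m + (m + 2 * L)) atTop atTop :=
    tendsto_atTop_mono (fun L => by rw [id]; omega) tendsto_id
  have h1 := (tendsto_prod_restricted hq (AllowedAbove m)).comp hsub
  refine tendsto_nhds_unique h1 (((((tendsto_qPoch (q ^ (2 * m + 2)) _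
    (norm_sq_lt_one hq)).const_mul _).inv₀ (mul_ne_zero hA hB))).congr fun L => ?_)
  rw [Function.comp_apply, prod_allowedAbove]

/-- `m` is the smallest part of `p`, it occurs once, and the odd parts are less than `2 * m`. -/
def IsUniqueSmallest {N : ℕ} (m : ℕ) (p : N.Partition) : Prop :=
  m ∈ p.parts ∧ (∀ k ∈ p.parts, m ≤ k) ∧ p.parts.count m = 1 ∧ ∀ k ∈ p.parts, Odd k → k < 2 * m

open scoped Classical in
theorem card_isUniqueSmallest {N m : ℕ} (h1 : 1 ≤ m) (hN : m ≤ N) :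
    #{p : N.Partition | IsUniqueSmallest m p} = #(restricted (N - m) (AllowedAbove m)) := by
  symm
  refine Finset.card_bij (fun p _ => ((partitionWithPartEquiv h1 hN).symm p).1) ?_ ?_ ?_
  · intro p hp
    simp only [restricted, mem_filter, mem_univ, true_and] at hp ⊢
    refine ⟨?_, ?_, ?_, ?_⟩
    · simp
    · simp only [partitionWithPartEquiv_symm_apply_parts, Multiset.mem_cons]
      rintro k (rfl | hk)
      · exact le_rfl
      · exact (hp k hk).1.le
    · rw [partitionWithPartEquiv_symm_apply_parts, Multiset.count_cons_self,
        Multiset.count_eq_zero_of_notMem fun hm => lt_irrefl _ (hp m hm).1]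
    · simp only [partitionWithPartEquiv_symm_apply_parts, Multiset.mem_cons]
      rintro k (rfl | hk) hodd
      · omega
      · exact (hp k hk).2 hodd
  · intro p _ p' _ h
    exact (partitionWithPartEquiv h1 hN).symm.injective (Subtype.ext h)
  · intro p hp
    simp only [mem_filter, mem_univ, true_and] at hp
    obtain ⟨hm, hmin, hcount, hodd⟩ := hp
    refine ⟨partitionWithPartEquiv h1 hN ⟨p, hm⟩, ?_, by simp⟩
    simp only [restricted, mem_filter, mem_univ, true_and, partitionWithPartEquiv_apply_parts]
    intro k hk
    have hk' := Multiset.mem_of_mem_erase hk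
    refine ⟨lt_of_le_of_ne (hmin k hk') ?_, hodd k hk'⟩
    rintro rfl
    have := Multiset.count_pos.mpr hk
    rw [Multiset.count_erase_self, hcount] at this
    exact lt_irrefl _ this

open scoped Classical in
theorem numUniqueSmallestOddBounded_eq_sum (N : ℕ) :
    numUniqueSmallestOddBounded N = ∑ x ∈ antidiagonal N,
      if x.1 = 0 then 0 else #(restricted x.2 (AllowedAbove x.1)) := by
  have hU : (univ.filter fun p : N.Partition => HasUniqueSmallestOddBounded p) =
      (range (N + 1)).biUnion fun m => {p : N.Partition | IsUniqueSmallest m p} := by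
    ext p
    simp only [mem_filter, mem_univ, true_and, mem_biUnion, mem_range]
    constructor
    · rintro ⟨m, hm, h⟩
      exact ⟨m, Nat.lt_succ_of_le (le_of_mem_parts hm), hm, h⟩
    · rintro ⟨m, -, hm, h⟩
      exact ⟨m, hm, h⟩
  -- The union is disjoint because a partition has only one smallest part.
  rw [numUniqueSmallestOddBounded, hU, card_biUnion, Nat.sum_antidiagonal_eq_sum_range_succ_mk]
  · refine sum_congr rfl fun m hm => ?_
    rcases Nat.eq_zero_or_pos m with rfl | hpos
    · rw [if_pos rfl, card_eq_zero, filter_eq_empty_iff]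
      intro p _ hp
      exact lt_irrefl _ (p.parts_pos hp.1)
    · rw [if_neg hpos.ne', card_isUniqueSmallest hpos (Nat.le_of_lt_succ (mem_range.mp hm))]
  · intro m _ m' _ hne
    rw [Function.onFun, disjoint_left]
    intro p hp hp'
    simp only [mem_filter, mem_univ, true_and] at hp hp'
    exact hne (le_antisymm (hp.2.1 _ hp'.1) (hp'.2.1 _ hp.1))

/-! ### Double summation over the smallest part and the rest -/

/-- The weight of the pairs (smallest part, sum of the other parts). -/
noncomputable def pairWeight (q : ℂ) (x : ℕ × ℕ) : ℂ :=
  ((if x.1 = 0 then 0 else #(restricted x.2 (AllowedAbove x.1)) : ℕ) : ℂ) * q ^ (x.1 + x.2)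

theorem tsum_pairWeight {q : ℂ} (hq : ‖q‖ < 1) (m : ℕ) :
    ∑' M, pairWeight q (m, M) = if m = 0 then 0 else
      q ^ m / (qPoch (q ^ (m + 1)) q m * qPochInf (q ^ (2 * m + 2)) (q ^ 2)) := by
  split_ifs with h
  · simp [pairWeight, h]
  · rw [div_eq_mul_inv, ← tsum_card_restricted_allowedAbove hq, ← tsum_mul_left]
    refine tsum_congr fun M => ?_
    simp only [pairWeight, if_neg h, pow_add]
    ring

theorem summable_ite_term {q : ℂ} (hq : ‖q‖ < 1) : Summable fun m : ℕ => if m = 0 then 0 else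
    q ^ m / (qPoch (q ^ (m + 1)) q m * qPochInf (q ^ (2 * m + 2)) (q ^ 2)) := by
  refine Summable.of_norm_bounded (summable_term hq).norm fun m => ?_
  split_ifs
  · rw [norm_zero]
    exact norm_nonneg _
  · exact le_rfl

theorem summable_pairWeight {q : ℂ} (hq : ‖q‖ < 1) : Summable (pairWeight q) := by
  have hr : ‖((‖q‖ : ℝ) : ℂ)‖ < 1 := by simpa using hq
  -- The coefficients are nonnegative, so the norms are the weights at the real point ‖q‖, whose row
  -- sums are already known.
  have e : ∀ x, ((‖pairWeight q x‖ : ℝ) : ℂ) = pairWeight (‖q‖ : ℝ) x := fun x => by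
    rw [pairWeight, pairWeight, norm_mul, norm_pow, Complex.norm_natCast, Complex.ofReal_mul,
      Complex.ofReal_natCast, Complex.ofReal_pow]
  refine Summable.of_norm ((summable_prod_of_nonneg fun _ => norm_nonneg _).mpr ⟨fun m => ?_, ?_⟩)
  · rcases eq_or_ne m 0 with rfl | hm
    · simp [pairWeight]
    · have := (summable_card_restricted_mul_pow (norm_nonneg q) hq (AllowedAbove m)).mul_left
        (‖q‖ ^ m)
      refine this.congr fun M => ?_
      rw [pairWeight, if_neg hm, norm_mul, norm_pow, Complex.norm_natCast, pow_add]
      ring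
  · rw [← Complex.summable_ofReal]
    simp only [Complex.ofReal_tsum, e, tsum_pairWeight hr]
    exact summable_ite_term hr

theorem hasSum_numUniqueSmallestOddBounded {q : ℂ} (hq : ‖q‖ < 1) :
    HasSum (fun N : ℕ => (numUniqueSmallestOddBounded N : ℂ) * q ^ N)
      (∑' n : ℕ+, q ^ (n : ℕ) /
        (qPoch (q ^ ((n : ℕ) + 1)) q n * qPochInf (q ^ (2 * (n : ℕ) + 2)) (q ^ 2))) := by
  have hs := summable_pairWeight hq
  have hval : ∑' x, pairWeight q x = ∑' n : ℕ+, q ^ (n : ℕ) /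
      (qPoch (q ^ ((n : ℕ) + 1)) q n * qPochInf (q ^ (2 * (n : ℕ) + 2)) (q ^ 2)) := by
    rw [hs.tsum_prod]
    simp only [tsum_pairWeight hq]
    rw [← tsum_zero_pnat_eq_tsum_nat (summable_ite_term hq)]
    simp
  have h := hs.hasSum
  rw [hval, ← HasAntidiagonal.sigmaAntidiagonalEquivProd.hasSum_iff] at h
  refine (h.sigma fun N => hasSum_fintype _).congr_fun fun N => ?_
  rw [numUniqueSmallestOddBounded_eq_sum, Nat.cast_sum, sum_mul, ← sum_coe_sort]
  refine sum_congr rfl fun x _ => ?_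
  change _ = pairWeight q x
  rw [pairWeight, mem_antidiagonal.mp x.2]

theorem mainTheorem6 (q : ℂ) (hq : ‖q‖ < 1) :
    (Summable fun n : ℕ+ =>
      q ^ (n : ℕ) /
        (qPoch (q ^ ((n : ℕ) + 1)) q n * qPochInf (q ^ (2 * (n : ℕ) + 2)) (q ^ 2))) ∧
    (Summable fun m : ℕ => q ^ (3 * m) / qPoch q (q ^ 2) (m + 1)) ∧
    HasSum (fun N : ℕ => (numUniqueSmallestOddBounded N : ℂ) * q ^ N)
      (∑' n : ℕ+,
        q ^ (n : ℕ) /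
          (qPoch (q ^ ((n : ℕ) + 1)) q n * qPochInf (q ^ (2 * (n : ℕ) + 2)) (q ^ 2))) ∧
    (∑' n : ℕ+,
        q ^ (n : ℕ) /
          (qPoch (q ^ ((n : ℕ) + 1)) q n * qPochInf (q ^ (2 * (n : ℕ) + 2)) (q ^ 2))) =
      q ^ 2 * (∑' m : ℕ, q ^ (3 * m) / qPoch q (q ^ 2) (m + 1)) +
        q / qPochInf (q ^ 2) (q ^ 2) := by
  exact ⟨(summable_term hq).comp_injective PNat.coe_injective, summable_cubic hq,
    hasSum_numUniqueSmallestOddBounded hq, tsum_term hq⟩
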